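/- Theorem (Rényi Littlewood–Offord). Let $n\ge 0$, let $v_1,\dots,v_n$ be nonzero real numbers, and let $B_1,\dots,B_n$ be independent Bernoulli random variables, $\mathbb P(B_i=1)=p_i=1-\mathbb P(B_i=0)$ with $p_i\in[0,1]$. Put $S_v=v_1B_1+\cdots+v_nB_n$ and $\sigma^2=\sum_{i=1}^n \mathrm{Var}(B_i)$. For $\alpha\in[2,\infty]$ let $\alpha'=\alpha/(\alpha-1)$ (with $\alpha'=1$ if $\alpha=\infty$), and let $$H_\alpha(S_v)=\frac{1}{1-\alpha}\log\sum_{x}\mathbb P(S_v=x)^\alpha\quad(2\le\alpha<\infty),\qquad H_\infty(S_v)=-\log\max_x\mathbb P(S_v=x)$$ be the Rényi entropy of order $\alpha$ (natural logarithm). Then $$H_\alpha(S_v)\ \ge\ \log\frac{\sqrt{6\sigma^2\alpha'}}{\int_0^{\sqrt{6\sigma^2\alpha'}}e^{-t^2/2}\,dt}\ \ge\ \frac12\max\left\{\log\left(1+2\alpha'\sigma^2\right),\ \log\left(\frac{12\alpha'\sigma^2}{\pi}\right)\right\}.$$ (If $\sigma^2=0$, the middle and the right-hand expressions are understood as their limits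 as $\sigma^2\downarrow 0$, which are both $0$.) -/

import Mathlib

open MeasureTheory ProbabilityTheory
open scoped ENNReal

/-- The Rényi entropy `H_α(X)` of order `α ∈ [0, ∞]` (natural logarithm) of a discrete random
variable `X : Ω → 𝒳` with probability mass function `f x = ℙ(X = x)`, as an extended real number.
For `α ∉ {0, 1, ∞}` it is `(1 - α)⁻¹ * log (∑ x, f x ^ α)`; at `0`, `1` and `∞` it is respectively
the logarithm of the size of the support, the Shannon entropy, and minus the logarithm of the
supremum of `f`. Here `ENNReal.log 0 = ⊥` and `ENNReal.log ⊤ = ⊤`. -/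
noncomputable def renyiEntropy {Ω 𝒳 : Type*} [MeasurableSpace Ω] (α : ℝ≥0∞) (X : Ω → 𝒳)
    (μ : Measure Ω) : EReal :=
  if α = 0 then
    ENNReal.log (({x : 𝒳 | μ (X ⁻¹' {x}) ≠ 0}.encard : ℕ∞) : ℝ≥0∞)
  else if α = 1 then
    ((∑' x : 𝒳, ENNReal.ofReal (Real.negMulLog (μ.real (X ⁻¹' {x}))) : ℝ≥0∞) : EReal)
  else if α = ∞ then
    -ENNReal.log (⨆ x : 𝒳, μ (X ⁻¹' {x}))
  else
    (((1 - α.toReal)⁻¹ : ℝ) : EReal) *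
      ENNReal.log (∑' x : 𝒳, μ (X ⁻¹' {x}) ^ α.toReal)

/-! A `ℚ`-linear functional on `ℝ` that vanishes at no `v i`, followed by clearing denominators and
reduction modulo a large prime `N`, turns the `v i` into units of `ZMod N`. This can only merge
atoms of the sum, so it increases `∑ P ^ r` and the largest atom. Hence it suffices to bound these
on `ZMod N` and let `N → ∞` through primes.

On `ZMod N`, Hausdorff–Young (Riesz–Thorin between the trivial bound and Parseval) bounds `∑ P ^ r`
by the `(r - 1)`-th power of the average of `|P̂| ^ q`. The transform is a product of Bernoulli
factors, each at most `exp (-p (1 - p) (1 - cos))`. Jensen's inequality with weights proportional to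
the variances, and the fact that units permute `ZMod N`, remove all dependence on the `v i`. The
average becomes a Riemann sum for the integral of `exp (-l sin² (π x))` over `[0, 1]`, with `l = 2
α' σ²`.

Finally `sin² (π w / 2)` and `3 w² / 2` have the same integral over `[0, 1]` and cross once, so
convexity of `exp` permits replacing the former by the latter. This yields the Gaussian integral;
the explicit bounds are elementary estimates of it. -/

/-! ### Riemann sums. -/

open Filter Topology in
/-- Left Riemann sums of a continuous function on `[0, 1]` converge to its integral. -/
lemma tendsto_riemann_sum {f : ℝ → ℝ} (hf : Continuous f) :
    Tendsto (fun N : ℕ => (∑ k ∈ Finset.range N, f (k / N)) / N) atTop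
      (𝓝 (∫ x in (0 : ℝ)..1, f x)) := by
  rw [Metric.tendsto_atTop]
  intro ε hε
  have huc : UniformContinuousOn f (Set.Icc 0 1) :=
    isCompact_Icc.uniformContinuousOn_of_continuous hf.continuousOn
  obtain ⟨δ, hδ, H⟩ := Metric.uniformContinuousOn_iff.1 huc (ε / 2) (by positivity)
  obtain ⟨M, hM⟩ := exists_nat_gt (1 / δ)
  refine ⟨M + 1, fun N hN => ?_⟩
  have hNpos : (0 : ℝ) < N := by
    have : 0 < N := by omega
    exact_mod_cast this
  have hNδ : 1 / (N : ℝ) < δ := by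
    rw [div_lt_comm₀ hNpos hδ]
    refine hM.trans ?_
    exact_mod_cast hN
  have hsum : ∫ x in (0 : ℝ)..1, f x
      = ∑ k ∈ Finset.range N, ∫ x in ((k : ℝ) / N)..((k + 1 : ℕ) : ℝ) / N, f x := by
    have := intervalIntegral.sum_integral_adjacent_intervals (μ := volume) (f := f)
      (a := fun k : ℕ => (k : ℝ) / N) (n := N) (fun k _ => hf.intervalIntegrable _ _)
    rw [this]
    simp [hNpos.ne']
  have hconst : (∑ k ∈ Finset.range N, f (k / N)) / N
      = ∑ k ∈ Finset.range N, ∫ _x in ((k : ℝ) / N)..((k + 1 : ℕ) : ℝ) / N, f (k / N) := by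
    rw [Finset.sum_div]
    refine Finset.sum_congr rfl fun k _ => ?_
    rw [intervalIntegral.integral_const, smul_eq_mul]
    push_cast
    field_simp
    ring
  rw [hsum, hconst, dist_eq_norm, ← Finset.sum_sub_distrib]
  calc _ ≤ ∑ k ∈ Finset.range N, (ε / 2) * (1 / N) := by
        refine norm_sum_le_of_le _ fun k hk => ?_
        rw [← intervalIntegral.integral_sub (by simp) (hf.intervalIntegrable _ _)]
        have hk' : (k : ℝ) + 1 ≤ N := by exact_mod_cast Finset.mem_range.1 hk
        have hle : (k : ℝ) / N ≤ ((k + 1 : ℕ) : ℝ) / N := by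
          push_cast; gcongr; linarith
        have hlen : ((k + 1 : ℕ) : ℝ) / N - (k : ℝ) / N = 1 / N := by push_cast; ring
        have := intervalIntegral.norm_integral_le_of_norm_le_const (C := ε / 2)
          (f := fun x => f (k / N) - f x) (a := (k : ℝ) / N) (b := ((k + 1 : ℕ) : ℝ) / N) ?_
        · rwa [hlen, abs_of_pos (by positivity)] at this
        · intro x hx
          rw [Set.uIoc_of_le hle] at hx
          have h0 : 0 ≤ (k : ℝ) / N := by positivity
          have h1 : ((k + 1 : ℕ) : ℝ) / N ≤ 1 := by
            rw [div_le_one hNpos]; push_cast; exact hk'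
          rw [← dist_eq_norm]
          refine (H _ ⟨h0, hle.trans h1⟩ _ ⟨h0.trans hx.1.le, hx.2.trans h1⟩ ?_).le
          rw [dist_comm, Real.dist_eq, abs_of_pos (by linarith [hx.1])]
          linarith [hx.2]
    _ = ε / 2 := by rw [Finset.sum_const, Finset.card_range, nsmul_eq_mul]; field_simp
    _ < ε := by linarith

/-! ### Comparison of `sin²` with a parabola. -/

/-- The graphs of `sin (π w / 2)` and of `√(3/2) w` cross exactly once in `(0, 1]`. -/
lemma exists_crossing_sin_sq :
    ∃ w₀ ∈ Set.Icc (0 : ℝ) 1, (∀ w ∈ Set.Icc 0 w₀, 3 / 2 * w ^ 2 ≤ Real.sin (Real.pi / 2 * w) ^ 2) ∧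
      ∀ w ∈ Set.Icc w₀ 1, Real.sin (Real.pi / 2 * w) ^ 2 ≤ 3 / 2 * w ^ 2 := by
  have hpi := Real.pi_pos
  set c : ℝ := √(3 / 2) with hc
  have hc2 : c ^ 2 = 3 / 2 := Real.sq_sqrt (by norm_num)
  have hc0 : 0 ≤ c := Real.sqrt_nonneg _
  -- A concave function vanishing at `0` and `w₀ > 0` is nonnegative between them and nonpositive
  -- beyond `w₀`. The zero `w₀` is found in `[1/2, 1]`, where `h` changes sign.
  set h : ℝ → ℝ := fun w => Real.sin (Real.pi / 2 * w) - c * w with hh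
  have hcont : Continuous h := by fun_prop
  have hconc : ConcaveOn ℝ (Set.Icc 0 1) h := by
    have h1 : ConcaveOn ℝ (Set.Icc 0 1) (fun w => Real.sin (Real.pi / 2 * w)) := by
      refine ⟨convex_Icc _ _, fun x hx y hy a b ha hb hab => ?_⟩
      have := strictConcaveOn_sin_Icc.concaveOn.2 (x := Real.pi / 2 * x) (y := Real.pi / 2 * y)
        ⟨by have := hx.1; positivity, by nlinarith [hx.2]⟩
        ⟨by have := hy.1; positivity, by nlinarith [hy.2]⟩ ha hb hab
      simp only [smul_eq_mul] at this ⊢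
      convert this using 2
      ring
    refine ⟨convex_Icc _ _, fun x hx y hy a b ha hb hab => ?_⟩
    have := h1.2 hx hy ha hb hab
    simp only [smul_eq_mul, hh] at this ⊢
    linarith
  have hhalf : 0 ≤ h (1 / 2) := by
    have : Real.sin (Real.pi / 2 * (1 / 2)) = √2 / 2 := by
      rw [← Real.sin_pi_div_four]; congr 1; ring
    simp only [hh, this]
    have : c ≤ √2 := Real.sqrt_le_sqrt (by norm_num)
    linarith
  have hone : h 1 ≤ 0 := by
    simp only [hh, mul_one, Real.sin_pi_div_two]
    have : 1 ≤ c := Real.one_le_sqrt.2 (by norm_num)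
    linarith
  have hzero : h 0 = 0 := by simp [hh]
  obtain ⟨w₀, hw₀, hw₀z⟩ := intermediate_value_Icc' (by norm_num : (1 / 2 : ℝ) ≤ 1)
    hcont.continuousOn ⟨hone, hhalf⟩
  have hw₀pos : 0 < w₀ := by linarith [hw₀.1]
  have hsin : ∀ w ∈ Set.Icc (0 : ℝ) 1, 0 ≤ Real.sin (Real.pi / 2 * w) := fun w hw =>
    Real.sin_nonneg_of_nonneg_of_le_pi (by have := hw.1; positivity) (by nlinarith [hw.2])
  refine ⟨w₀, ⟨hw₀pos.le, hw₀.2⟩, fun w hw => ?_, fun w hw => ?_⟩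
  · have hw1 : w ∈ Set.Icc (0 : ℝ) 1 := ⟨hw.1, hw.2.trans hw₀.2⟩
    have hpos : 0 ≤ h w := by
      have := hconc.2 (Set.left_mem_Icc.2 zero_le_one) (show w₀ ∈ Set.Icc 0 1 from ⟨hw₀pos.le, hw₀.2⟩)
        (show 0 ≤ 1 - w / w₀ by rw [sub_nonneg, div_le_one hw₀pos]; exact hw.2)
        (show 0 ≤ w / w₀ from div_nonneg hw.1 hw₀pos.le) (by ring)
      simp only [smul_eq_mul, hzero, hw₀z, mul_zero, add_zero, zero_add] at this
      rwa [div_mul_cancel₀ _ hw₀pos.ne'] at this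
    rw [← hc2, ← mul_pow]
    exact pow_le_pow_left₀ (mul_nonneg hc0 hw.1) (by simpa [hh] using hpos) 2
  · have hw1 : w ∈ Set.Icc (0 : ℝ) 1 := ⟨hw₀pos.le.trans hw.1, hw.2⟩
    have hwpos : 0 < w := hw₀pos.trans_le hw.1
    have hneg : h w ≤ 0 := by
      have := hconc.2 (Set.left_mem_Icc.2 zero_le_one) hw1
        (show 0 ≤ 1 - w₀ / w by rw [sub_nonneg, div_le_one hwpos]; exact hw.1)
        (show 0 ≤ w₀ / w by positivity) (by ring)
      simp only [smul_eq_mul, hzero, mul_zero, zero_add] at this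
      rw [div_mul_cancel₀ _ hwpos.ne', hw₀z] at this
      exact nonpos_of_mul_nonpos_right this (by positivity)
    rw [← hc2, ← mul_pow]
    exact pow_le_pow_left₀ (hsin w hw1) (by simpa [hh] using hneg) 2

lemma integral_sin_sq_quarter : ∫ w in (0 : ℝ)..1, Real.sin (Real.pi / 2 * w) ^ 2 = 1 / 2 := by
  rw [intervalIntegral.integral_comp_mul_left (fun x => Real.sin x ^ 2) (by positivity),
    integral_sin_sq]
  simp
  field_simp

/-- A majorization argument: the factor `3 / 2` makes both exponents have integral `1 / 2`, so with
a single crossing the tangent-line bound for the convex function `exp` integrates to the claim. -/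
lemma integral_exp_sin_sq_quarter_le {l : ℝ} (hl : 0 ≤ l) :
    ∫ w in (0 : ℝ)..1, Real.exp (-(l * Real.sin (Real.pi / 2 * w) ^ 2))
      ≤ ∫ w in (0 : ℝ)..1, Real.exp (-(l * (3 / 2 * w ^ 2))) := by
  obtain ⟨w₀, hw₀, h1, h2⟩ := exists_crossing_sin_sq
  have hpi := Real.pi_pos
  set a : ℝ → ℝ := fun w => Real.sin (Real.pi / 2 * w) ^ 2 with ha
  set b : ℝ → ℝ := fun w => 3 / 2 * w ^ 2 with hb
  have hac : Continuous a := by fun_prop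
  have hbc : Continuous b := by fun_prop
  have hmono : ∀ x y, 0 ≤ x → x ≤ y → y ≤ 1 → a x ≤ a y := by
    intro x y hx hxy hy
    refine pow_le_pow_left₀ (Real.sin_nonneg_of_nonneg_of_le_pi (by positivity) (by nlinarith)) ?_ 2
    exact Real.sin_le_sin_of_le_of_le_pi_div_two (by nlinarith [mul_nonneg hpi.le hx]) (by nlinarith)
      (by nlinarith)
  -- The slope of the tangent at `a w` is replaced by its value at the crossing. The error has the
  -- right sign because `b - a` and `exp (-(l * a w)) - exp (-(l * a w₀))` have opposite signs on
  -- each side of `w₀`. The slope is now constant, so the correction term integrates to `0`.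
  have key : ∀ w ∈ Set.Icc (0 : ℝ) 1,
      Real.exp (-(l * a w)) - l * Real.exp (-(l * a w₀)) * (b w - a w) ≤ Real.exp (-(l * b w)) := by
    intro w hw
    have e1 : Real.exp (-(l * a w)) * (1 - l * (b w - a w)) ≤ Real.exp (-(l * b w)) := by
      have : -(l * b w) = -(l * a w) + (-(l * (b w - a w))) := by ring
      rw [this, Real.exp_add]
      gcongr
      linarith [Real.add_one_le_exp (-(l * (b w - a w)))]
    have e2 : (b w - a w) * (Real.exp (-(l * a w)) - Real.exp (-(l * a w₀))) ≤ 0 := by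
      rcases le_total w w₀ with h | h
      · refine mul_nonpos_of_nonpos_of_nonneg (sub_nonpos.2 (h1 w ⟨hw.1, h⟩)) (sub_nonneg.2 ?_)
        have := hmono w w₀ hw.1 h hw₀.2
        gcongr
      · refine mul_nonpos_of_nonneg_of_nonpos (sub_nonneg.2 (h2 w ⟨h, hw.2⟩)) (sub_nonpos.2 ?_)
        have := hmono w₀ w hw₀.1 h hw.2
        gcongr
    nlinarith [mul_nonpos_of_nonneg_of_nonpos hl e2]
  have hint : ∫ w in (0 : ℝ)..1,
      (Real.exp (-(l * a w)) - l * Real.exp (-(l * a w₀)) * (b w - a w))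
      = ∫ w in (0 : ℝ)..1, Real.exp (-(l * a w)) := by
    rw [intervalIntegral.integral_sub
      (Continuous.intervalIntegrable (by fun_prop) _ _)
      (Continuous.intervalIntegrable (by fun_prop) _ _), intervalIntegral.integral_const_mul,
      intervalIntegral.integral_sub (hbc.intervalIntegrable _ _) (hac.intervalIntegrable _ _),
      integral_sin_sq_quarter, intervalIntegral.integral_const_mul, integral_pow]
    norm_num
  rw [← hint]
  exact intervalIntegral.integral_mono_on zero_le_one
    (Continuous.intervalIntegrable (by fun_prop) _ _)
    (Continuous.intervalIntegrable (by fun_prop) _ _) key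

/-- The symmetry `x ↦ 1 - x` and the scaling `x = w / 2` reduce the full period to the quarter wave.
-/
lemma integral_exp_sin_sq_le {l : ℝ} (hl : 0 ≤ l) :
    ∫ x in (0 : ℝ)..1, Real.exp (-(l * Real.sin (Real.pi * x) ^ 2))
      ≤ ∫ w in (0 : ℝ)..1, Real.exp (-(l * (3 / 2 * w ^ 2))) := by
  refine le_trans (le_of_eq ?_) (integral_exp_sin_sq_quarter_le hl)
  set f : ℝ → ℝ := fun x => Real.exp (-(l * Real.sin (Real.pi * x) ^ 2)) with hf
  have hfc : Continuous f := by fun_prop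
  have hsymm : ∫ x in (1 / 2 : ℝ)..1, f x = ∫ x in (0 : ℝ)..(1 / 2), f x := by
    have := intervalIntegral.integral_comp_sub_left f (a := 0) (b := 1 / 2) 1
    rw [show (1 : ℝ) - 1 / 2 = 1 / 2 by norm_num, sub_zero] at this
    rw [← this]
    refine intervalIntegral.integral_congr fun x _ => ?_
    simp only [hf]
    rw [mul_sub, mul_one, Real.sin_pi_sub]
  have hhalf : ∫ w in (0 : ℝ)..1, Real.exp (-(l * Real.sin (Real.pi / 2 * w) ^ 2))
      = 2 * ∫ x in (0 : ℝ)..(1 / 2), f x := by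
    have := intervalIntegral.integral_comp_mul_left f (a := 0) (b := 1) (c := 1 / 2) (by norm_num)
    simp only [mul_zero, mul_one, smul_eq_mul, one_div, inv_inv] at this
    rw [one_div, ← this]
    refine intervalIntegral.integral_congr fun x _ => ?_
    simp only [hf]
    ring_nf
  rw [hhalf, ← intervalIntegral.integral_add_adjacent_intervals (b := 1 / 2)
    (hfc.intervalIntegrable _ _) (hfc.intervalIntegrable _ _), hsymm]
  ring

/-! ### Bounds on the Gaussian integral. -/

lemma integral_exp_neg_sq_pos {R : ℝ} (hR : 0 < R) :
    0 < ∫ t in (0 : ℝ)..R, Real.exp (-t ^ 2 / 2) :=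
  intervalIntegral.intervalIntegral_pos_of_pos
    (Continuous.intervalIntegrable (by fun_prop) _ _) (fun _ => Real.exp_pos _) hR

lemma integral_exp_neg_sq_le_sqrt {R : ℝ} (hR : 0 ≤ R) :
    ∫ t in (0 : ℝ)..R, Real.exp (-t ^ 2 / 2) ≤ √(Real.pi / 2) := by
  have hi : Integrable (fun t : ℝ => Real.exp (-(1 / 2) * t ^ 2)) :=
    integrable_exp_neg_mul_sq (by norm_num)
  have h := integral_gaussian_Ioi (1 / 2)
  have e : √(Real.pi / (1 / 2)) / 2 = √(Real.pi / 2) := by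
    rw [show Real.pi / (1 / 2) = 2 ^ 2 * (Real.pi / 2) by ring, Real.sqrt_mul (by norm_num),
      Real.sqrt_sq (by norm_num)]
    ring
  rw [← e, ← h, intervalIntegral.integral_of_le hR]
  have e2 : ∀ t : ℝ, Real.exp (-t ^ 2 / 2) = Real.exp (-(1 / 2) * t ^ 2) := fun t => by ring_nf
  simp only [e2]
  exact setIntegral_mono_set hi.integrableOn (ae_of_all _ fun t => (Real.exp_pos _).le)
    (LE.le.eventuallyLE Set.Ioc_subset_Ioi_self)

/-- The right side is the antiderivative of `(1 + t² / 3) ^ (-3 / 2)`, which dominates `exp (-t² /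
2)` because `1 + t² / 3 ≤ exp (t² / 3)`. -/
lemma integral_exp_neg_sq_le_div_sqrt {R : ℝ} (hR : 0 ≤ R) :
    ∫ t in (0 : ℝ)..R, Real.exp (-t ^ 2 / 2) ≤ R / √(1 + R ^ 2 / 3) := by
  have hpos : ∀ t : ℝ, 0 < 1 + t ^ 2 / 3 := fun t => by positivity
  have hderiv : ∀ t : ℝ, HasDerivAt (fun t => t / √(1 + t ^ 2 / 3))
      (((1 + t ^ 2 / 3) * √(1 + t ^ 2 / 3))⁻¹) t := by
    intro t
    have h1 : HasDerivAt (fun t : ℝ => 1 + t ^ 2 / 3) (2 * t / 3) t := by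
      simpa using ((hasDerivAt_pow 2 t).div_const 3).const_add 1
    have h2 := (hasDerivAt_id' t).div (h1.sqrt (hpos t).ne') (Real.sqrt_pos.2 (hpos t)).ne'
    refine h2.congr_deriv ?_
    have hs : √(1 + t ^ 2 / 3) ^ 2 = 1 + t ^ 2 / 3 := Real.sq_sqrt (hpos t).le
    have hs0 : 0 < √(1 + t ^ 2 / 3) := Real.sqrt_pos.2 (hpos t)
    set s := √(1 + t ^ 2 / 3)
    rw [← hs]
    field_simp
    nlinarith
  have hcont : Continuous fun t : ℝ => ((1 + t ^ 2 / 3) * √(1 + t ^ 2 / 3))⁻¹ :=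
    Continuous.inv₀ (by fun_prop)
      fun t => (mul_pos (hpos t) (Real.sqrt_pos.2 (hpos t))).ne'
  have hFTC := intervalIntegral.integral_eq_sub_of_hasDerivAt (a := 0) (b := R)
    (fun t _ => hderiv t) (hcont.intervalIntegrable _ _)
  rw [zero_div, sub_zero] at hFTC
  rw [← hFTC]
  refine intervalIntegral.integral_mono_on hR (Continuous.intervalIntegrable (by fun_prop) _ _)
    (hcont.intervalIntegrable _ _) fun t _ => ?_
  rw [show -t ^ 2 / 2 = -(t ^ 2 / 3 + t ^ 2 / 6) by ring, Real.exp_neg, Real.exp_add]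
  have hs : √(1 + t ^ 2 / 3) ≤ Real.exp (t ^ 2 / 6) := by
    rw [Real.sqrt_le_left (Real.exp_pos _).le, ← Real.exp_nat_mul]
    refine (add_comm _ _).trans_le ((Real.add_one_le_exp _).trans_eq ?_)
    congr 1
    push_cast
    ring
  have h1 : 1 + t ^ 2 / 3 ≤ Real.exp (t ^ 2 / 3) := by linarith [Real.add_one_le_exp (t ^ 2 / 3)]
  have := hpos t
  have := Real.sqrt_pos.2 (hpos t)
  gcongr

/-- The lower bounds on `log (R / ∫₀ᴿ exp (-t²/2))`, for `R ≥ 0`. -/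
lemma half_max_log_le_log_div_integral {R : ℝ} (hR : 0 ≤ R) :
    1 / 2 * max (Real.log (1 + R ^ 2 / 3)) (Real.log (2 * R ^ 2 / Real.pi))
      ≤ Real.log (R / ∫ t in (0 : ℝ)..R, Real.exp (-t ^ 2 / 2)) := by
  -- At `R = 0` the conventions `0 / 0 = 0` and `log 0 = 0` make both sides `0`, in agreement with
  -- the limits.
  rcases hR.eq_or_lt with rfl | hR
  · simp
  have hI := integral_exp_neg_sq_pos hR
  have half : ∀ y : ℝ, 0 ≤ y → 1 / 2 * Real.log y = Real.log √y := fun y hy => by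
    rw [Real.log_sqrt hy]; ring
  rw [mul_max_of_nonneg _ _ (by norm_num), half _ (by positivity), half _ (by positivity)]
  refine max_le (Real.log_le_log (by positivity) ?_) (Real.log_le_log (by positivity) ?_)
  · have := integral_exp_neg_sq_le_div_sqrt hR.le
    rwa [le_div_comm₀ (by positivity) hI]
  · have := integral_exp_neg_sq_le_sqrt hR.le
    rw [show 2 * R ^ 2 / Real.pi = R ^ 2 / (Real.pi / 2) by field_simp, Real.sqrt_div (by positivity),
      Real.sqrt_sq hR.le]
    gcongr

/-- Substitution `t = R u`; the right side needs no convention at `R = 0`. -/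
lemma log_div_integral_eq {R : ℝ} (hR : 0 ≤ R) :
    Real.log (R / ∫ t in (0 : ℝ)..R, Real.exp (-t ^ 2 / 2))
      = -Real.log (∫ u in (0 : ℝ)..1, Real.exp (-(R ^ 2 * u ^ 2 / 2))) := by
  rcases hR.eq_or_lt with rfl | hR
  · simp
  rw [← Real.log_inv]
  congr 1
  have := intervalIntegral.integral_comp_mul_left (fun t => Real.exp (-t ^ 2 / 2)) (a := 0) (b := 1)
    hR.ne'
  simp only [mul_zero, mul_one, smul_eq_mul] at this
  rw [show (fun u : ℝ => Real.exp (-(R ^ 2 * u ^ 2 / 2))) = fun u => Real.exp (-(R * u) ^ 2 / 2) by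
    ext u; ring_nf, this, mul_inv, inv_inv, div_eq_mul_inv]

/-! ### Riesz–Thorin interpolation for bilinear forms. -/

/-- The analytic family `z ↦ sgn(x) |x| ^ (p (1 - z / 2))` used in complex interpolation. -/
noncomputable def interpFamily (p : ℝ) (x z : ℂ) : ℂ :=
  if x = 0 then 0 else x / ‖x‖ * (‖x‖ : ℂ) ^ ((p : ℂ) * (1 - z / 2))

lemma differentiable_interpFamily (p : ℝ) (x : ℂ) : Differentiable ℂ (interpFamily p x) := by
  unfold interpFamily
  split_ifs with h
  · fun_prop
  · have : (‖x‖ : ℂ) ≠ 0 := by exact_mod_cast norm_ne_zero_iff.2 h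
    refine Differentiable.const_mul ?_ _
    exact Differentiable.const_cpow (by fun_prop) (Or.inl this)

/-- The phase has modulus one, so only the real part of the exponent counts. That exponent must be
nonzero since `0 ^ 0 = 1`, whereas the family vanishes at `x = 0`. -/
lemma norm_interpFamily {p : ℝ} (x z : ℂ) (hp : p * (1 - z.re / 2) ≠ 0) :
    ‖interpFamily p x z‖ = ‖x‖ ^ (p * (1 - z.re / 2)) := by
  unfold interpFamily
  split_ifs with h
  · simp [h, Real.zero_rpow hp]
  · have hx : 0 < ‖x‖ := norm_pos_iff.2 h
    rw [norm_mul, norm_div, Complex.norm_real, norm_norm, div_self hx.ne', one_mul,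
      Complex.norm_cpow_eq_rpow_re_of_pos hx]
    congr 1
    simp

lemma interpFamily_self {p t : ℝ} (x : ℂ) (h : p * (1 - t / 2) = 1) :
    interpFamily p x t = x := by
  unfold interpFamily
  split_ifs with hx
  · exact hx.symm
  · have hx' : (‖x‖ : ℂ) ≠ 0 := by exact_mod_cast norm_ne_zero_iff.2 hx
    have : (p : ℂ) * (1 - (t : ℂ) / 2) = 1 := by exact_mod_cast h
    rw [this, Complex.cpow_one, div_mul_cancel₀ _ hx']

lemma norm_le_one_of_sum_rpow_eq_one {ι : Type*} [Fintype ι] {p : ℝ} (hp : 0 < p) {u : ι → ℂ}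
    (hu : ∑ j, ‖u j‖ ^ p = 1) (j : ι) : ‖u j‖ ≤ 1 := by
  have := Finset.single_le_sum (f := fun j => ‖u j‖ ^ p) (fun i _ => by positivity)
    (Finset.mem_univ j)
  rw [hu] at this
  by_contra! h
  exact absurd (Real.one_lt_rpow h hp) (not_lt.2 this)

lemma eq_zero_of_sum_norm_rpow_eq_zero {ι : Type*} [Fintype ι] {p : ℝ} (hp : 0 < p) {u : ι → ℂ}
    (hu : ∑ j, ‖u j‖ ^ p = 0) (j : ι) : u j = 0 := by
  have := (Finset.sum_eq_zero_iff_of_nonneg fun i _ => by positivity).1 hu j (Finset.mem_univ j)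
  rwa [Real.rpow_eq_zero (norm_nonneg _) hp.ne', norm_eq_zero] at this

lemma sum_norm_div_rpow_eq_one {ι : Type*} [Fintype ι] {p : ℝ} (hp : 0 < p) {u : ι → ℂ}
    (hu : 0 < ∑ j, ‖u j‖ ^ p) :
    ∑ j, ‖u j / (((∑ j, ‖u j‖ ^ p) ^ (1 / p) : ℝ) : ℂ)‖ ^ p = 1 := by
  have : ∀ j, ‖u j / (((∑ j, ‖u j‖ ^ p) ^ (1 / p) : ℝ) : ℂ)‖ ^ p
      = ‖u j‖ ^ p / ∑ j, ‖u j‖ ^ p := fun j => by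
    rw [norm_div, Complex.norm_real, Real.norm_of_nonneg (by positivity),
      Real.div_rpow (norm_nonneg _) (by positivity), ← Real.rpow_mul hu.le,
      one_div_mul_cancel hp.ne', Real.rpow_one]
  simp_rw [this, ← Finset.sum_div, div_self hu.ne']

/-- Riesz–Thorin interpolation between `ℓ¹ × ℓ¹` and `ℓ² × ℓ²` for a finite bilinear form,
for vectors normalized in `ℓᵖ`. -/
lemma norm_bilin_le_of_sum_rpow_eq_one {ι κ : Type*} [Fintype ι] [Fintype κ] (A : ι → κ → ℂ) {C : ℝ}
    (hA1 : ∀ j k, ‖A j k‖ ≤ 1)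
    (hA2 : ∀ (x : ι → ℂ) (y : κ → ℂ), ∑ j, ‖x j‖ ^ 2 = 1 → ∑ k, ‖y k‖ ^ 2 = 1 →
      ‖∑ j, ∑ k, x j * A j k * y k‖ ≤ C)
    {p t : ℝ} (ht0 : 0 ≤ t) (ht1 : t ≤ 1) (hpt : p * (1 - t / 2) = 1)
    (x : ι → ℂ) (y : κ → ℂ) (hx : ∑ j, ‖x j‖ ^ p = 1) (hy : ∑ k, ‖y k‖ ^ p = 1) :
    ‖∑ j, ∑ k, x j * A j k * y k‖ ≤ C ^ t := by
  have hp : 0 < p := by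
    by_contra! h
    nlinarith
  -- The moduli of the entries are raised to `p` on `re z = 0` and to `p / 2` on `re z = 1`, so the
  -- deformed vectors are `ℓ¹`- and `ℓ²`-normalized there. At `z = t` the exponent is `1` and `x`,
  -- `y` are recovered. The three lines theorem interpolates the bounds `1` and `C`.
  set f : ℂ → ℂ := fun z => ∑ j, ∑ k, interpFamily p (x j) z * A j k * interpFamily p (y k) z
    with hf
  have hne : ∀ z : ℂ, z ∈ Complex.HadamardThreeLines.verticalClosedStrip 0 1 →
      p * (1 - z.re / 2) ≠ 0 := fun z hz => by
    have : z.re ≤ 1 := hz.2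
    have : 0 < 1 - z.re / 2 := by linarith
    positivity
  have hfd : Differentiable ℂ f := by
    refine Differentiable.fun_sum fun j _ => Differentiable.fun_sum fun k _ => ?_
    exact ((differentiable_interpFamily p (x j)).mul_const _).mul (differentiable_interpFamily p (y k))
  have hfam : ∀ u z : ℂ, z ∈ Complex.HadamardThreeLines.verticalClosedStrip 0 1 → ‖u‖ ≤ 1 →
      ‖interpFamily p u z‖ ≤ 1 := fun u z hz hu => by
    rw [norm_interpFamily _ _ (hne z hz)]
    have : z.re ≤ 1 := hz.2
    exact Real.rpow_le_one (norm_nonneg _) hu (mul_nonneg hp.le (by linarith))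
  have hterm : ∀ z j k, ‖interpFamily p (x j) z * A j k * interpFamily p (y k) z‖
      ≤ ‖interpFamily p (x j) z‖ * ‖interpFamily p (y k) z‖ := fun z j k => by
    rw [norm_mul, norm_mul]
    gcongr
    exact mul_le_of_le_one_right (norm_nonneg _) (hA1 j k)
  have hf0 : ∀ z, ‖f z‖ ≤ (∑ j, ‖interpFamily p (x j) z‖) * ∑ k, ‖interpFamily p (y k) z‖ :=
    fun z => by
      rw [Finset.sum_mul_sum]
      exact norm_sum_le_of_le _ fun j _ => norm_sum_le_of_le _ fun k _ => hterm z j k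
  have hbdd : BddAbove ((norm ∘ f) '' Complex.HadamardThreeLines.verticalClosedStrip 0 1) := by
    refine ⟨Fintype.card ι * Fintype.card κ, ?_⟩
    rintro _ ⟨z, hz, rfl⟩
    refine (hf0 z).trans ?_
    have h1 := Finset.sum_le_sum fun j (_ : j ∈ Finset.univ) => hfam (x j) z hz (norm_le_one_of_sum_rpow_eq_one hp hx j)
    have h2 := Finset.sum_le_sum fun k (_ : k ∈ Finset.univ) => hfam (y k) z hz (norm_le_one_of_sum_rpow_eq_one hp hy k)
    simp only [Finset.sum_const, Finset.card_univ, nsmul_eq_mul, mul_one] at h1 h2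
    gcongr
  have hft : f t = ∑ j, ∑ k, x j * A j k * y k := by
    simp only [hf, interpFamily_self _ hpt]
  have h0 : ∀ z ∈ Complex.re ⁻¹' {(0 : ℝ)}, ‖f z‖ ≤ 1 := fun z hz => by
    have hz' : z.re = 0 := hz
    refine (hf0 z).trans_eq ?_
    simp_rw [norm_interpFamily (p := p) _ z (by rw [hz']; simpa using hp.ne'), hz', zero_div,
      sub_zero, mul_one, hx, hy, mul_one]
  have h1 : ∀ z ∈ Complex.re ⁻¹' {(1 : ℝ)}, ‖f z‖ ≤ C := fun z hz => by
    have hz' : z.re = 1 := hz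
    have hsq : ∀ u : ℂ, ‖interpFamily p u z‖ ^ 2 = ‖u‖ ^ p := fun u => by
      rw [norm_interpFamily _ _ (by rw [hz']; norm_num; exact hp.ne'), hz', ← Real.rpow_natCast,
        ← Real.rpow_mul (norm_nonneg _)]
      congr 1
      push_cast
      ring
    exact hA2 _ _ (by simp_rw [hsq, hx]) (by simp_rw [hsq, hy])
  have := Complex.HadamardThreeLines.norm_le_interp_of_mem_verticalClosedStrip₀₁' f (z := t)
    (by simpa [Complex.HadamardThreeLines.verticalClosedStrip] using ⟨ht0, ht1⟩) hfd.diffContOnCl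
    hbdd h0 h1
  simpa [hft] using this

/-- Riesz–Thorin interpolation between `ℓ¹ × ℓ¹` and `ℓ² × ℓ²` for a finite bilinear form. -/
lemma norm_bilin_le {ι κ : Type*} [Fintype ι] [Fintype κ] (A : ι → κ → ℂ) {C : ℝ}
    (hA1 : ∀ j k, ‖A j k‖ ≤ 1) (hC : 0 ≤ C)
    (hA2 : ∀ (x : ι → ℂ) (y : κ → ℂ), ∑ j, ‖x j‖ ^ 2 = 1 → ∑ k, ‖y k‖ ^ 2 = 1 →
      ‖∑ j, ∑ k, x j * A j k * y k‖ ≤ C)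
    {p t : ℝ} (ht0 : 0 ≤ t) (ht1 : t ≤ 1) (hpt : p * (1 - t / 2) = 1)
    (x : ι → ℂ) (y : κ → ℂ) :
    ‖∑ j, ∑ k, x j * A j k * y k‖
      ≤ C ^ t * (∑ j, ‖x j‖ ^ p) ^ (1 / p) * (∑ k, ‖y k‖ ^ p) ^ (1 / p) := by
  have hp : 0 < p := by
    by_contra! h
    nlinarith
  have hrhs : 0 ≤ C ^ t * (∑ j, ‖x j‖ ^ p) ^ (1 / p) * (∑ k, ‖y k‖ ^ p) ^ (1 / p) := by positivity
  rcases (Finset.sum_nonneg fun j (_ : j ∈ Finset.univ) =>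
    Real.rpow_nonneg (norm_nonneg (x j)) p).eq_or_lt with hX | hX
  · simpa [eq_zero_of_sum_norm_rpow_eq_zero hp hX.symm] using hrhs
  rcases (Finset.sum_nonneg fun k (_ : k ∈ Finset.univ) =>
    Real.rpow_nonneg (norm_nonneg (y k)) p).eq_or_lt with hY | hY
  · simpa [eq_zero_of_sum_norm_rpow_eq_zero hp hY.symm] using hrhs
  set a : ℝ := (∑ j, ‖x j‖ ^ p) ^ (1 / p) with ha
  set b : ℝ := (∑ k, ‖y k‖ ^ p) ^ (1 / p) with hb
  have ha0 : 0 < a := by positivity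
  have hb0 : 0 < b := by positivity
  have key := norm_bilin_le_of_sum_rpow_eq_one A hA1 hA2 ht0 ht1 hpt (fun j => x j / a)
    (fun k => y k / b) (sum_norm_div_rpow_eq_one hp hX) (sum_norm_div_rpow_eq_one hp hY)
  have e : ∑ j, ∑ k, x j / a * A j k * (y k / b)
      = (∑ j, ∑ k, x j * A j k * y k) / ((a * b : ℝ) : ℂ) := by
    rw [Finset.sum_div]
    refine Finset.sum_congr rfl fun j _ => ?_
    rw [Finset.sum_div]
    refine Finset.sum_congr rfl fun k _ => ?_
    push_cast
    ring
  rw [e, norm_div, Complex.norm_real, Real.norm_of_nonneg (by positivity),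
    div_le_iff₀ (by positivity)] at key
  linarith

/-! ### Fourier analysis on `ZMod N`. -/

section ZMod
variable {N : ℕ} [NeZero N]

open ZMod

lemma norm_stdAddChar (a : ZMod N) : ‖stdAddChar a‖ = 1 := by
  rw [stdAddChar_apply, Circle.norm_coe]

lemma sum_stdAddChar_mul (b : ZMod N) :
    ∑ k : ZMod N, stdAddChar (k * b) = if b = 0 then (N : ℂ) else 0 := by
  rw [AddChar.sum_mulShift b (isPrimitive_stdAddChar N), ZMod.card]
  split_ifs <;> simp

lemma sum_stdAddChar_mul_dft (g : ZMod N → ℂ) (j : ZMod N) :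
    ∑ k : ZMod N, stdAddChar (j * k) * ZMod.dft g k = N * g j := by
  have := congrFun (ZMod.dft.symm_apply_apply g) j
  rw [ZMod.invDFT_apply, smul_eq_mul, inv_mul_eq_iff_eq_mul₀ (NeZero.ne _)] at this
  rw [← this]
  exact Finset.sum_congr rfl fun k _ => by rw [smul_eq_mul, mul_comm j]

/-- Parseval's identity on `ZMod N`. -/
lemma sum_norm_sq_sum_stdAddChar (y : ZMod N → ℂ) :
    ∑ j : ZMod N, ‖∑ k, stdAddChar (j * k) * y k‖ ^ 2 = N * ∑ k, ‖y k‖ ^ 2 := by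
  have hsq : ∀ z : ℂ, ((‖z‖ ^ 2 : ℝ) : ℂ) = z * starRingEnd ℂ z := fun z => by
    rw [Complex.mul_conj, Complex.normSq_eq_norm_sq]
  have hconj : ∀ a : ZMod N, starRingEnd ℂ (stdAddChar a) = stdAddChar (-a) := fun a => by
    rw [AddChar.map_neg_eq_conj]
  apply Complex.ofReal_injective
  rw [Complex.ofReal_mul, Complex.ofReal_sum, Complex.ofReal_sum]
  simp_rw [hsq, map_sum, map_mul, hconj, Finset.sum_mul_sum]
  rw [Finset.sum_comm]
  push_cast
  rw [Finset.mul_sum]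
  refine Finset.sum_congr rfl fun k _ => ?_
  rw [Finset.sum_comm]
  have : ∀ l : ZMod N, ∑ j : ZMod N, stdAddChar (j * k) * y k *
      (stdAddChar (-(j * l)) * starRingEnd ℂ (y l))
      = (if l = k then (N : ℂ) else 0) * (y k * starRingEnd ℂ (y l)) := fun l => by
    have h := sum_stdAddChar_mul (k - l)
    simp only [sub_eq_zero, eq_comm (a := k)] at h
    rw [← h, Finset.sum_mul]
    refine Finset.sum_congr rfl fun j _ => ?_
    rw [mul_sub, sub_eq_add_neg, AddChar.map_add_eq_mul]
    ring
  simp_rw [this]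
  simp

/-- The Hausdorff–Young inequality on `ZMod N` for nonnegative functions. -/
lemma sum_rpow_le_of_dft (g : ZMod N → ℝ) (hg : ∀ j, 0 ≤ g j) {r q : ℝ} (hr : 2 ≤ r)
    (hrq : r.HolderConjugate q) :
    ∑ j, g j ^ r ≤
      ((∑ k, ‖ZMod.dft (fun j => (g j : ℂ)) k‖ ^ q) / N) ^ (r - 1) := by
  have hr0 : 0 < r := by linarith
  have hq0 : 0 < q := hrq.symm.pos
  have hN : (0 : ℝ) < N := by exact_mod_cast Nat.pos_of_ne_zero (NeZero.ne N)
  set F : ZMod N → ℂ := ZMod.dft fun j => (g j : ℂ) with hF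
  have hL2 : ∀ x y : ZMod N → ℂ, ∑ j, ‖x j‖ ^ 2 = 1 → ∑ k, ‖y k‖ ^ 2 = 1 →
      ‖∑ j, ∑ k, x j * stdAddChar (j * k) * y k‖ ≤ √N := by
    intro x y hx hy
    have e : ∀ j, ∑ k, x j * stdAddChar (j * k) * y k = x j * ∑ k, stdAddChar (j * k) * y k :=
      fun j => by rw [Finset.mul_sum]; exact Finset.sum_congr rfl fun k _ => by ring
    simp_rw [e]
    have h1 : ‖∑ j, x j * ∑ k, stdAddChar (j * k) * y k‖
        ≤ ∑ j, ‖x j‖ * ‖∑ k, stdAddChar (j * k) * y k‖ :=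
      norm_sum_le_of_le _ fun j _ => (norm_mul _ _).le
    have h2 := Real.sum_mul_le_sqrt_mul_sqrt Finset.univ (fun j => ‖x j‖)
      (fun j => ‖∑ k, stdAddChar (j * k) * y k‖)
    rw [sum_norm_sq_sum_stdAddChar, hx, hy] at h2
    simpa using h1.trans h2
  have hinv := hrq.inv_add_inv_eq_one
  -- The choice `t = 2 / r` gives the interpolated exponent `q`. Testing the inverse transform of
  -- `F` against the dual vector `g ^ (r - 1)` gives `N * T` on the left, while its `q`-th powers
  -- sum to `T` as `(r - 1) * q = r`. Cancelling `T ^ (1 / q)` leaves the claim up to an `r`-th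
  -- power.
  have hbil := norm_bilin_le (fun j k : ZMod N => stdAddChar (j * k))
    (fun j k => (norm_stdAddChar _).le) (Real.sqrt_nonneg N) hL2 (p := q) (t := 2 / r)
    (by positivity) ((div_le_one hr0).2 hr)
    (by rw [div_div_cancel_left' two_ne_zero, show 1 - r⁻¹ = q⁻¹ by linarith,
          mul_inv_cancel₀ hq0.ne'])
    (fun j => ((g j ^ (r - 1) : ℝ) : ℂ)) F
  set T : ℝ := ∑ j, g j ^ r with hT
  set U : ℝ := ∑ k, ‖F k‖ ^ q with hU
  have hT0 : 0 ≤ T := Finset.sum_nonneg fun j _ => Real.rpow_nonneg (hg j) _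
  have hU0 : 0 ≤ U := Finset.sum_nonneg fun j _ => by positivity
  have hrm : (r - 1) * q = r := by rw [hrq.sub_one_mul_conj]
  have hlhs : ∑ j, ∑ k, ((g j ^ (r - 1) : ℝ) : ℂ) * stdAddChar (j * k) * F k = ((N * T : ℝ) : ℂ) := by
    push_cast
    rw [hT, Complex.ofReal_sum, Finset.mul_sum]
    refine Finset.sum_congr rfl fun j _ => ?_
    simp_rw [mul_assoc]
    rw [← Finset.mul_sum, sum_stdAddChar_mul_dft]
    have : g j ^ r = g j ^ (r - 1) * g j := by
      rcases (hg j).eq_or_lt with h | h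
      · rw [← h, Real.zero_rpow hr0.ne', mul_zero]
      · rw [Real.rpow_sub_one h.ne', div_mul_cancel₀ _ h.ne']
    rw [this]
    push_cast
    ring
  have hx : ∑ j, ‖((g j ^ (r - 1) : ℝ) : ℂ)‖ ^ q = T := by
    refine Finset.sum_congr rfl fun j _ => ?_
    rw [Complex.norm_real, Real.norm_of_nonneg (Real.rpow_nonneg (hg j) _),
      ← Real.rpow_mul (hg j), hrm]
  rw [hlhs, hx, Complex.norm_real, Real.norm_of_nonneg (by positivity)] at hbil
  rcases hT0.eq_or_lt with h | hTpos
  · rw [← h]; positivity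
  have hsqrt : √(N : ℝ) ^ (2 / r) = N * (N : ℝ) ^ (-(1 / q)) := by
    rw [Real.sqrt_eq_rpow, ← Real.rpow_mul hN.le, ← Real.rpow_one_add' hN.le]
    · congr 1
      rw [one_div q]
      field_simp
      field_simp at hinv
      linarith
    · rw [one_div, show 1 + -q⁻¹ = r⁻¹ by linarith]; positivity
  have hTdecomp : T = T ^ (1 / r) * T ^ (1 / q) := by
    rw [← Real.rpow_add hTpos, one_div, one_div, hinv, Real.rpow_one]
  have hmain : T ^ (1 / r) ≤ (U / N) ^ (1 / q) := by
    have hTq : 0 < T ^ (1 / q) := by positivity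
    rw [Real.div_rpow hU0 hN.le, div_eq_mul_inv (U ^ _), ← Real.rpow_neg hN.le]
    refine le_of_mul_le_mul_right ?_ (mul_pos hN hTq)
    calc T ^ (1 / r) * (N * T ^ (1 / q)) = N * T := by
          conv_rhs => rw [hTdecomp]
          ring
      _ ≤ _ := hbil
      _ = _ := by rw [hsqrt]; ring
  have := Real.rpow_le_rpow (by positivity) hmain hr0.le
  rw [← Real.rpow_mul hT0, ← Real.rpow_mul (by positivity), one_div_mul_cancel hr0.ne',
    Real.rpow_one] at this
  refine this.trans_eq ?_
  congr 1
  rw [one_div_mul_eq_div, div_eq_iff hq0.ne', hrm]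

/-- The endpoint `r = ∞`, `q = 1` of Hausdorff–Young: Fourier inversion and the triangle inequality.
-/
lemma le_sum_norm_dft_div (g : ZMod N → ℝ) (j : ZMod N) :
    g j ≤ (∑ k, ‖ZMod.dft (fun j => (g j : ℂ)) k‖) / N := by
  have hN : (0 : ℝ) < N := by exact_mod_cast Nat.pos_of_ne_zero (NeZero.ne N)
  have h := congrArg norm (sum_stdAddChar_mul_dft (fun j => (g j : ℂ)) j)
  rw [norm_mul, Complex.norm_natCast, Complex.norm_real] at h
  rw [le_div_iff₀ hN]
  calc g j * N ≤ N * ‖g j‖ := by rw [mul_comm]; gcongr; exact Real.le_norm_self _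
    _ ≤ _ := h ▸ norm_sum_le_of_le _ fun k _ => by rw [norm_mul, norm_stdAddChar, one_mul]

end ZMod

/-! ### From real coefficients to units modulo a prime. -/

lemma addChar_map_sum_eq_prod {A M κ : Type*} [AddCommMonoid A] [CommMonoid M] (ψ : AddChar A M)
    (s : Finset κ) (f : κ → A) : ψ (∑ i ∈ s, f i) = ∏ i ∈ s, ψ (f i) := by
  classical
  induction s using Finset.induction_on with
  | empty => simp
  | insert a s ha ih => rw [Finset.sum_insert ha, Finset.prod_insert ha, AddChar.map_add_eq_mul, ih]

/-- Over the infinite field `ℚ`, some functional on `ℝ` avoids zero on finitely many nonzero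
vectors. A common denominator `b` makes its values on subset sums integers, so taking `num` there
loses nothing. -/
lemma exists_int_factorsThrough {ι : Type*} [Finite ι] {v : ι → ℝ} (hv : ∀ i, v i ≠ 0) :
    ∃ (m : ι → ℤ) (φ : ℝ → ℤ), (∀ i, m i ≠ 0) ∧
      ∀ s : Finset ι, φ (∑ i ∈ s, v i) = ∑ i ∈ s, m i := by
  obtain ⟨f, hf⟩ := Module.exists_dual_forall_apply_ne_zero (K := ℚ) v hv
  obtain ⟨b, hb⟩ := IsLocalization.exist_integer_multiples_of_finite (nonZeroDivisors ℤ)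
    (fun i => f (v i))
  choose m hm using hb
  have hm' : ∀ i, (m i : ℚ) = (b : ℤ) * f (v i) := fun i => by
    have := hm i
    simpa [zsmul_eq_mul] using this
  have hb0 : ((b : ℤ) : ℚ) ≠ 0 := by exact_mod_cast nonZeroDivisors.coe_ne_zero b
  refine ⟨m, fun x => ((b : ℤ) * f x).num, fun i h => ?_, fun s => ?_⟩
  · have := hm' i
    rw [h, Int.cast_zero, eq_comm, mul_eq_zero] at this
    exact this.elim hb0 (hf i)
  · have : (b : ℤ) * f (∑ i ∈ s, v i) = ((∑ i ∈ s, m i : ℤ) : ℚ) := by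
      rw [map_sum, Finset.mul_sum, Int.cast_sum]
      exact Finset.sum_congr rfl fun i _ => (hm' i).symm
    simp only [this, Rat.num_intCast]

lemma eventually_isUnit_intCast_of_prime {ι : Type*} [Finite ι] {m : ι → ℤ} (hm : ∀ i, m i ≠ 0) :
    ∀ᶠ N : ℕ in Filter.atTop, N.Prime → ∀ i, IsUnit (m i : ZMod N) := by
  refine (Filter.eventually_all.2 fun i => Filter.eventually_gt_atTop (m i).natAbs).mono
    fun N hN hprime i => ?_
  have := Fact.mk hprime
  rw [isUnit_iff_ne_zero, Ne, ZMod.intCast_zmod_eq_zero_iff_dvd]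
  intro hdvd
  have := Nat.le_of_dvd (Int.natAbs_pos.2 (hm i)) (Int.natCast_dvd.1 hdvd)
  exact absurd (hN i) (not_lt.2 this)

/-! ### The mass function of a weighted Bernoulli sum. -/

section BernoulliSum
variable {ι : Type*} [Fintype ι] [DecidableEq ι]

/-- The probability that independent Bernoulli variables with parameters `p i` equal `1` exactly for
`i ∈ s`. -/
noncomputable def bernoulliWeight (p : ι → ℝ) (s : Finset ι) : ℝ :=
  (∏ i ∈ s, p i) * ∏ i ∈ Finset.univ \ s, (1 - p i)

lemma bernoulliWeight_nonneg {p : ι → ℝ} (hp : ∀ i, p i ∈ Set.Icc (0 : ℝ) 1) (s : Finset ι) :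
    0 ≤ bernoulliWeight p s :=
  mul_nonneg (Finset.prod_nonneg fun i _ => (hp i).1)
    (Finset.prod_nonneg fun i _ => sub_nonneg.2 (hp i).2)

/-- The probability mass function of `∑ i, B i • w i` for independent Bernoulli variables `B i`. -/
noncomputable def bernoulliSumMass {G : Type*} [AddCommMonoid G] [DecidableEq G] (p : ι → ℝ)
    (w : ι → G) (x : G) : ℝ :=
  ∑ s : Finset ι with ∑ i ∈ s, w i = x, bernoulliWeight p s

lemma bernoulliSumMass_nonneg {G : Type*} [AddCommMonoid G] [DecidableEq G] {p : ι → ℝ}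
    (hp : ∀ i, p i ∈ Set.Icc (0 : ℝ) 1) (w : ι → G) (x : G) : 0 ≤ bernoulliSumMass p w x :=
  Finset.sum_nonneg fun s _ => bernoulliWeight_nonneg hp s

open ZMod in
-- Expanding the product over subsets and grouping them by the value of the subset sum gives the
-- transform.
lemma dft_bernoulliSumMass {N : ℕ} [NeZero N] (p : ι → ℝ) (w : ι → ZMod N) (k : ZMod N) :
    ZMod.dft (fun j => (bernoulliSumMass p w j : ℂ)) k
      = ∏ i, ((p i : ℂ) * stdAddChar (-(w i * k)) + (1 - p i)) := by
  rw [ZMod.dft_apply, Finset.prod_add, Finset.powerset_univ,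
    ← Finset.sum_fiberwise _ (fun s : Finset ι => ∑ i ∈ s, w i)]
  refine Finset.sum_congr rfl fun j _ => ?_
  rw [bernoulliSumMass, Complex.ofReal_sum, smul_eq_mul, Finset.mul_sum]
  refine Finset.sum_congr rfl fun s hs => ?_
  rw [← (Finset.mem_filter.1 hs).2, bernoulliWeight, Finset.prod_mul_distrib, Finset.sum_mul,
    ← Finset.sum_neg_distrib, addChar_map_sum_eq_prod]
  push_cast
  ring

/-- The squared modulus is exactly `1 - 2 p (1 - p) (1 - re z)`; then `1 + x ≤ exp x`. -/
lemma norm_mul_add_one_sub_le (p : ℝ) {z : ℂ} (hz : ‖z‖ = 1) :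
    ‖(p : ℂ) * z + (1 - p)‖ ≤ Real.exp (-(p * (1 - p) * (1 - z.re))) := by
  have h1 : ‖(p : ℂ) * z + (1 - p)‖ ^ 2 = 1 - 2 * (p * (1 - p) * (1 - z.re)) := by
    have h2 : z.re * z.re + z.im * z.im = 1 := by
      rw [← Complex.normSq_apply, Complex.normSq_eq_norm_sq, hz]; norm_num
    rw [← Complex.normSq_eq_norm_sq, Complex.normSq_apply]
    simp
    linear_combination p ^ 2 * h2
  refine le_of_sq_le_sq ?_ (Real.exp_pos _).le
  rw [h1, ← Real.exp_nat_mul]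
  refine le_trans ?_ (Real.add_one_le_exp _)
  push_cast
  linarith

open ZMod in
-- This is where the coefficients disappear. Jensen with weights `p i * (1 - p i) / V` bounds the
-- exponential of the sum by an average of single-frequency terms, and multiplication by the unit `w
-- i` merely permutes the sum over `k`.
lemma sum_norm_dft_bernoulliSumMass_rpow_le {N : ℕ} [NeZero N] {p : ι → ℝ}
    (hp : ∀ i, p i ∈ Set.Icc (0 : ℝ) 1) {w : ι → ZMod N} (hw : ∀ i, IsUnit (w i)) {q : ℝ}
    (hq : 0 ≤ q) :
    ∑ k, ‖ZMod.dft (fun j => (bernoulliSumMass p w j : ℂ)) k‖ ^ q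
      ≤ ∑ k : ZMod N, Real.exp (-(q * (∑ i, p i * (1 - p i)) * (1 - (stdAddChar k).re))) := by
  set V : ℝ := ∑ i, p i * (1 - p i) with hV
  have hvar : ∀ i, 0 ≤ p i * (1 - p i) := fun i => mul_nonneg (hp i).1 (sub_nonneg.2 (hp i).2)
  have hre : ∀ a : ZMod N, (stdAddChar (-a)).re = (stdAddChar a).re := fun a => by
    rw [AddChar.map_neg_eq_conj, Complex.conj_re]
  have hpt : ∀ k, ‖ZMod.dft (fun j => (bernoulliSumMass p w j : ℂ)) k‖ ^ q
      ≤ Real.exp (∑ i, p i * (1 - p i) * -(q * (1 - (stdAddChar (w i * k)).re))) := fun k => by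
    rw [dft_bernoulliSumMass, norm_prod, ← Real.finsetProd_rpow _ _ fun i _ => norm_nonneg _,
      Real.exp_sum]
    refine Finset.prod_le_prod (fun i _ => by positivity) fun i _ => ?_
    refine (Real.rpow_le_rpow (norm_nonneg _)
      (norm_mul_add_one_sub_le (p i) (norm_stdAddChar _)) hq).trans_eq ?_
    rw [← Real.exp_mul, hre]
    congr 1
    ring
  -- If `V = 0` the Jensen weights cannot be normalized, but every exponent vanishes.
  rcases (Finset.sum_nonneg fun i (_ : i ∈ Finset.univ) => hvar i).eq_or_lt with h0 | hVpos
  · have hz : ∀ i, p i * (1 - p i) = 0 := fun i =>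
      (Finset.sum_eq_zero_iff_of_nonneg fun i _ => hvar i).1 h0.symm i (Finset.mem_univ i)
    refine Finset.sum_le_sum fun k _ => (hpt k).trans_eq ?_
    simp [hz, hV]
  have hVpos : 0 < V := hVpos
  have hjensen : ∀ k, Real.exp (∑ i, p i * (1 - p i) * -(q * (1 - (stdAddChar (w i * k)).re)))
      ≤ ∑ i, p i * (1 - p i) / V * Real.exp (-(q * V * (1 - (stdAddChar (w i * k)).re))) :=
    fun k => by
      have := convexOn_exp.map_sum_le (t := Finset.univ) (w := fun i => p i * (1 - p i) / V)
        (p := fun i => -(q * V * (1 - (stdAddChar (w i * k)).re)))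
        (fun i _ => div_nonneg (hvar i) hVpos.le)
        (by rw [← Finset.sum_div, div_self hVpos.ne']) fun i _ => Set.mem_univ _
      simp only [smul_eq_mul] at this
      refine le_of_eq_of_le ?_ this
      congr 1
      refine Finset.sum_congr rfl fun i _ => ?_
      field_simp
  have hshift : ∀ i, ∑ k, Real.exp (-(q * V * (1 - (stdAddChar (w i * k)).re)))
      = ∑ k : ZMod N, Real.exp (-(q * V * (1 - (stdAddChar k).re))) := fun i =>
    (hw i).unit.mulLeft_bijective.sum_comp
      fun k : ZMod N => Real.exp (-(q * V * (1 - (stdAddChar k).re)))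
  refine (Finset.sum_le_sum fun k _ => (hpt k).trans (hjensen k)).trans_eq ?_
  rw [Finset.sum_comm]
  simp_rw [← Finset.mul_sum, hshift]
  rw [← Finset.sum_mul, ← Finset.sum_div, div_self hVpos.ne', one_mul]

open ZMod in
lemma sum_exp_stdAddChar_eq (N : ℕ) [NeZero N] (l : ℝ) :
    ∑ k : ZMod N, Real.exp (-(l * (1 - (stdAddChar k).re)))
      = ∑ k ∈ Finset.range N, Real.exp (-(2 * l * Real.sin (Real.pi * (k / N)) ^ 2)) := by
  refine Finset.sum_nbij' ZMod.val (fun k => (k : ZMod N)) (fun k _ => by simp [ZMod.val_lt])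
    (by simp) (by simp) (fun k hk => ZMod.val_cast_of_lt (Finset.mem_range.1 hk)) fun k _ => ?_
  have hre : (stdAddChar k).re = Real.cos (2 * (Real.pi * (k.val / N))) := by
    rw [stdAddChar_apply, toCircle_apply, ← Complex.exp_ofReal_mul_I_re]
    congr 2
    push_cast
    ring
  rw [hre, Real.cos_two_mul, Real.cos_sq']
  congr 1
  ring

lemma sum_rpow_le_rpow_sum {κ : Type*} (s : Finset κ) {F : κ → ℝ} (hF : ∀ x, 0 ≤ F x) {r : ℝ}
    (hr : 1 ≤ r) : ∑ x ∈ s, F x ^ r ≤ (∑ x ∈ s, F x) ^ r := by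
  classical
  induction s using Finset.induction_on with
  | empty => simp [Real.zero_rpow (by linarith : r ≠ 0)]
  | insert a s ha ih =>
    rw [Finset.sum_insert ha, Finset.sum_insert ha]
    refine (add_le_add_right ih _).trans ?_
    exact Real.add_rpow_le_rpow_add (hF a) (Finset.sum_nonneg fun x _ => hF x) hr

lemma bernoulliSumMass_eq_sum_of_factorsThrough {G H : Type*} [AddCommMonoid G] [AddCommMonoid H]
    [DecidableEq G] [DecidableEq H] (p : ι → ℝ) {v : ι → G} {w : ι → H} {φ : G → H}
    (hφ : ∀ s : Finset ι, φ (∑ i ∈ s, v i) = ∑ i ∈ s, w i) (y : H) :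
    bernoulliSumMass p w y = ∑ x ∈ Finset.univ.image (fun s : Finset ι => ∑ i ∈ s, v i) with φ x = y,
      bernoulliSumMass p v x := by
  unfold bernoulliSumMass
  rw [← Finset.sum_fiberwise_of_maps_to (g := fun s : Finset ι => ∑ i ∈ s, v i)
    (t := {x ∈ Finset.univ.image (fun s : Finset ι => ∑ i ∈ s, v i) | φ x = y})]
  · refine Finset.sum_congr rfl fun x hx => Finset.sum_congr ?_ fun _ _ => rfl
    ext s
    simp only [Finset.mem_filter, Finset.mem_univ, true_and, and_iff_right_iff_imp]
    rintro rfl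
    rw [← hφ, (Finset.mem_filter.1 hx).2]
  · intro s hs
    simp only [Finset.mem_filter, Finset.mem_univ, true_and] at hs
    simp [hφ, hs]

/-- Merging atoms increases the sum of `r`-th powers of the masses. -/
lemma sum_bernoulliSumMass_rpow_le_of_factorsThrough {G H : Type*} [AddCommMonoid G]
    [AddCommMonoid H] [DecidableEq G] [DecidableEq H] [Fintype H] {p : ι → ℝ}
    (hp : ∀ i, p i ∈ Set.Icc (0 : ℝ) 1) {v : ι → G} {w : ι → H} {φ : G → H}
    (hφ : ∀ s : Finset ι, φ (∑ i ∈ s, v i) = ∑ i ∈ s, w i) {r : ℝ} (hr : 1 ≤ r) :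
    ∑ x ∈ Finset.univ.image (fun s : Finset ι => ∑ i ∈ s, v i), bernoulliSumMass p v x ^ r
      ≤ ∑ y, bernoulliSumMass p w y ^ r := by
  rw [← Finset.sum_fiberwise _ φ]
  refine Finset.sum_le_sum fun y _ => ?_
  rw [bernoulliSumMass_eq_sum_of_factorsThrough p hφ]
  exact sum_rpow_le_rpow_sum _ (bernoulliSumMass_nonneg hp v) hr

lemma bernoulliSumMass_le_of_factorsThrough {G H : Type*} [AddCommMonoid G]
    [AddCommMonoid H] [DecidableEq G] [DecidableEq H] {p : ι → ℝ}
    (hp : ∀ i, p i ∈ Set.Icc (0 : ℝ) 1) {v : ι → G} {w : ι → H} {φ : G → H}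
    (hφ : ∀ s : Finset ι, φ (∑ i ∈ s, v i) = ∑ i ∈ s, w i) (x : G) :
    bernoulliSumMass p v x ≤ bernoulliSumMass p w (φ x) := by
  refine Finset.sum_le_sum_of_subset_of_nonneg ?_ fun s _ _ => bernoulliWeight_nonneg hp s
  intro s hs
  simp only [Finset.mem_filter, Finset.mem_univ, true_and] at hs ⊢
  rw [← hφ, hs]

lemma tendsto_riemann_sum_exp_sin_sq (l : ℝ) :
    Filter.Tendsto (fun N : ℕ => (∑ k ∈ Finset.range N,
      Real.exp (-(l * Real.sin (Real.pi * (k / N)) ^ 2))) / N) Filter.atTop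
      (nhds (∫ x in (0 : ℝ)..1, Real.exp (-(l * Real.sin (Real.pi * x) ^ 2)))) :=
  tendsto_riemann_sum (f := fun x => Real.exp (-(l * Real.sin (Real.pi * x) ^ 2))) (by fun_prop)

/-- An inequality holding frequently passes to the limit, and there are infinitely many primes. -/
lemma le_of_forall_prime_le {a b : ℝ} {u : ℕ → ℝ} (hu : Filter.Tendsto u Filter.atTop (nhds b))
    (h : ∀ᶠ N : ℕ in Filter.atTop, N.Prime → a ≤ u N) : a ≤ b := by
  refine ge_of_tendsto_of_frequently hu ?_
  have hprime : ∃ᶠ N : ℕ in Filter.atTop, N.Prime :=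
    Nat.frequently_atTop_iff_infinite.2 Nat.infinite_setOfPred_prime
  exact (hprime.and_eventually h).mono fun N hN => hN.2 hN.1

lemma sum_bernoulliSumMass_rpow_le {p : ι → ℝ} (hp : ∀ i, p i ∈ Set.Icc (0 : ℝ) 1) {v : ι → ℝ}
    (hv : ∀ i, v i ≠ 0) {r q : ℝ} (hr : 2 ≤ r) (hrq : r.HolderConjugate q) :
    ∑ x ∈ Finset.univ.image (fun s : Finset ι => ∑ i ∈ s, v i), bernoulliSumMass p v x ^ r
      ≤ (∫ u in (0 : ℝ)..1,
          Real.exp (-(2 * (q * ∑ i, p i * (1 - p i)) * (3 / 2 * u ^ 2)))) ^ (r - 1) := by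
  obtain ⟨m, φ, hm, hφ⟩ := exists_int_factorsThrough hv
  have hV : 0 ≤ ∑ i, p i * (1 - p i) :=
    Finset.sum_nonneg fun i _ => mul_nonneg (hp i).1 (sub_nonneg.2 (hp i).2)
  have hq := hrq.symm.nonneg
  set l : ℝ := 2 * (q * ∑ i, p i * (1 - p i)) with hl
  refine le_trans ?_ (Real.rpow_le_rpow (intervalIntegral.integral_nonneg zero_le_one
    fun u _ => (Real.exp_pos _).le) (integral_exp_sin_sq_le (l := l) (by positivity)) (by linarith))
  refine le_of_forall_prime_le ((tendsto_riemann_sum_exp_sin_sq l).rpow_const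
    (Or.inr (by linarith))) ((eventually_isUnit_intCast_of_prime hm).mono fun N hN hprime => ?_)
  have : NeZero N := ⟨hprime.ne_zero⟩
  refine (sum_bernoulliSumMass_rpow_le_of_factorsThrough hp (H := ZMod N)
    (w := fun i => (m i : ZMod N)) (φ := fun x => (φ x : ZMod N)) (fun s => by simp [hφ])
    (by linarith)).trans ?_
  refine (sum_rpow_le_of_dft _ (bernoulliSumMass_nonneg hp _) hr hrq).trans ?_
  rw [hl, ← sum_exp_stdAddChar_eq]
  have := sum_norm_dft_bernoulliSumMass_rpow_le hp (hN hprime) hq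
  gcongr
  linarith

/-- The case `r = ∞`, with the triangle inequality in place of Hausdorff–Young. The factor `1 *` is
the conjugate exponent, kept for uniformity with finite `r`. -/
lemma bernoulliSumMass_le {p : ι → ℝ} (hp : ∀ i, p i ∈ Set.Icc (0 : ℝ) 1) {v : ι → ℝ}
    (hv : ∀ i, v i ≠ 0) (x : ℝ) :
    bernoulliSumMass p v x
      ≤ ∫ u in (0 : ℝ)..1, Real.exp (-(2 * (1 * ∑ i, p i * (1 - p i)) * (3 / 2 * u ^ 2))) := by
  obtain ⟨m, φ, hm, hφ⟩ := exists_int_factorsThrough hv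
  have hV : 0 ≤ ∑ i, p i * (1 - p i) :=
    Finset.sum_nonneg fun i _ => mul_nonneg (hp i).1 (sub_nonneg.2 (hp i).2)
  set l : ℝ := 2 * (1 * ∑ i, p i * (1 - p i)) with hl
  refine le_trans ?_ (integral_exp_sin_sq_le (l := l) (by positivity))
  refine le_of_forall_prime_le (tendsto_riemann_sum_exp_sin_sq l)
    ((eventually_isUnit_intCast_of_prime hm).mono fun N hN hprime => ?_)
  have : NeZero N := ⟨hprime.ne_zero⟩
  refine (bernoulliSumMass_le_of_factorsThrough hp (H := ZMod N)
    (w := fun i => (m i : ZMod N)) (φ := fun x => (φ x : ZMod N)) (fun s => by simp [hφ]) x).trans ?_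
  refine (le_sum_norm_dft_div _ _).trans ?_
  rw [hl, ← sum_exp_stdAddChar_eq]
  have := sum_norm_dft_bernoulliSumMass_rpow_le hp (hN hprime) zero_le_one
  simp only [Real.rpow_one] at this
  gcongr

end BernoulliSum

/-! ### From random variables to mass functions. -/

section Law
variable {Ω : Type*} [MeasurableSpace Ω] {μ : Measure Ω}

lemma measure_preimage_one_of_hasLaw_bernoulli {X : Ω → ℝ} {p : unitInterval}
    (hX : HasLaw X (bernoulliMeasure (1 : ℝ) 0 p) μ) :
    μ (X ⁻¹' {1}) = ENNReal.ofReal p := by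
  rw [← Measure.map_apply_of_aemeasurable hX.aemeasurable (measurableSet_singleton _), hX.map_eq,
    bernoulliMeasure_apply_of_mem_of_notMem p (measurableSet_singleton _) (by simp) (by simp)]
  exact (ENNReal.ofReal_eq_coe_nnreal p.2.1).symm

lemma measure_preimage_zero_of_hasLaw_bernoulli {X : Ω → ℝ} {p : unitInterval}
    (hX : HasLaw X (bernoulliMeasure (1 : ℝ) 0 p) μ) :
    μ (X ⁻¹' {0}) = ENNReal.ofReal (1 - p) := by
  rw [← Measure.map_apply_of_aemeasurable hX.aemeasurable (measurableSet_singleton _), hX.map_eq,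
    bernoulliMeasure_apply_of_notMem_of_mem p (measurableSet_singleton _) (by simp) (by simp)]
  exact (ENNReal.ofReal_eq_coe_nnreal (unitInterval.symm p).2.1).symm

lemma ae_eq_zero_or_one_of_hasLaw_bernoulli {X : Ω → ℝ} {p : unitInterval}
    (hX : HasLaw X (bernoulliMeasure (1 : ℝ) 0 p) μ) : ∀ᵐ ω ∂μ, X ω = 0 ∨ X ω = 1 := by
  have hs : MeasurableSet ({0, 1} : Set ℝ) := (Set.toFinite _).measurableSet
  have h : μ (X ⁻¹' {0, 1}ᶜ) = 0 := by
    rw [← Measure.map_apply_of_aemeasurable hX.aemeasurable hs.compl, hX.map_eq,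
      bernoulliMeasure_apply_of_notMem_of_notMem p hs.compl (by simp) (by simp)]
  rw [ae_iff]
  convert h using 2
  ext ω
  simp

lemma variance_of_hasLaw_bernoulli {X : Ω → ℝ} {p : unitInterval}
    (hX : HasLaw X (bernoulliMeasure (1 : ℝ) 0 p) μ) : variance X μ = p * (1 - p) := by
  rw [hX.variance_eq, variance_eq_integral aemeasurable_id, integral_bernoulliMeasure,
    integral_bernoulliMeasure]
  simp
  ring

/-- Up to a null set the event is covered by the outcomes `E s`, whose probabilities follow from
independence. Only an upper bound is needed, so subadditivity suffices. -/
lemma measure_sum_bernoulli_le {ι : Type*} [Fintype ι] [DecidableEq ι] (v : ι → ℝ) {B : ι → Ω → ℝ}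
    {p : ι → unitInterval} (hB : ∀ i, HasLaw (B i) (bernoulliMeasure (1 : ℝ) 0 (p i)) μ)
    (hindep : iIndepFun B μ) (x : ℝ) :
    μ ((fun ω => ∑ i, v i * B i ω) ⁻¹' {x})
      ≤ ENNReal.ofReal (bernoulliSumMass (fun i => (p i : ℝ)) v x) := by
  have hp : ∀ i, (p i : ℝ) ∈ Set.Icc (0 : ℝ) 1 := fun i => (p i).2
  set E : Finset ι → Set Ω := fun s => ⋂ i, B i ⁻¹' {if i ∈ s then 1 else 0} with hE
  have hμE : ∀ s, μ (E s) = ENNReal.ofReal (bernoulliWeight (fun i => (p i : ℝ)) s) := fun s => by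
    have h1 : ∀ i, μ (B i ⁻¹' {if i ∈ s then 1 else 0})
        = ENNReal.ofReal (if i ∈ s then (p i : ℝ) else 1 - p i) := fun i => by
      split_ifs
      · exact measure_preimage_one_of_hasLaw_bernoulli (hB i)
      · exact measure_preimage_zero_of_hasLaw_bernoulli (hB i)
    rw [hE, hindep.meas_iInter fun i => ⟨_, measurableSet_singleton _, rfl⟩]
    simp_rw [h1]
    rw [← ENNReal.ofReal_prod_of_nonneg, bernoulliWeight, Finset.prod_ite]
    · congr 3
      · ext; simp
      · ext; simp
    · intro i _
      split_ifs
      exacts [(hp i).1, sub_nonneg.2 (hp i).2]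
  have hcover : (fun ω => ∑ i, v i * B i ω) ⁻¹' {x}
      ≤ᵐ[μ] ⋃ s ∈ ({s | ∑ i ∈ s, v i = x} : Finset (Finset ι)), E s := by
    filter_upwards [ae_all_iff.2 fun i => ae_eq_zero_or_one_of_hasLaw_bernoulli (hB i)] with ω hω hx
    have hval : ∀ i, B i ω = if i ∈ ({i | B i ω = 1} : Finset ι) then 1 else 0 := fun i => by
      rcases hω i with h | h <;> simp [h]
    have hx' : ∑ i, v i * B i ω = x := hx
    refine Set.mem_biUnion (x := ({i | B i ω = 1} : Finset ι)) ?_ (Set.mem_iInter.2 hval)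
    simp only [Finset.coe_filter, Finset.mem_univ, true_and, Set.mem_ofPred_eq]
    rw [← hx', Finset.sum_filter]
    refine Finset.sum_congr rfl fun i _ => ?_
    rcases hω i with h | h <;> simp [h]
  calc _ ≤ _ := measure_mono_ae hcover
    _ ≤ ∑ s ∈ ({s | ∑ i ∈ s, v i = x} : Finset (Finset ι)), μ (E s) := measure_biUnion_finset_le _ _
    _ = _ := by
      simp_rw [hμE]
      rw [bernoulliSumMass, ENNReal.ofReal_sum_of_nonneg fun s _ => bernoulliWeight_nonneg hp s]

lemma tsum_measure_sum_bernoulli_rpow_le {ι : Type*} [Fintype ι] [DecidableEq ι] (v : ι → ℝ)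
    {B : ι → Ω → ℝ} {p : ι → unitInterval}
    (hB : ∀ i, HasLaw (B i) (bernoulliMeasure (1 : ℝ) 0 (p i)) μ) (hindep : iIndepFun B μ) {r : ℝ}
    (hr : 0 < r) :
    ∑' x, μ ((fun ω => ∑ i, v i * B i ω) ⁻¹' {x}) ^ r
      ≤ ENNReal.ofReal (∑ x ∈ Finset.univ.image (fun s : Finset ι => ∑ i ∈ s, v i),
          bernoulliSumMass (fun i => (p i : ℝ)) v x ^ r) := by
  have hnn := bernoulliSumMass_nonneg (fun i => (p i).2) v
  rw [ENNReal.ofReal_sum_of_nonneg fun x _ => Real.rpow_nonneg (hnn x) r]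
  have hle : ∀ x, μ ((fun ω => ∑ i, v i * B i ω) ⁻¹' {x}) ^ r
      ≤ ENNReal.ofReal (bernoulliSumMass (fun i => (p i : ℝ)) v x ^ r) := fun x => by
    rw [← ENNReal.ofReal_rpow_of_nonneg (hnn x) hr.le]
    exact ENNReal.rpow_le_rpow (measure_sum_bernoulli_le v hB hindep x) hr.le
  refine (ENNReal.tsum_le_tsum hle).trans_eq (tsum_eq_sum fun x hx => ?_)
  have : bernoulliSumMass (fun i => (p i : ℝ)) v x = 0 := by
    refine Finset.sum_eq_zero fun s hs => absurd ?_ hx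
    exact Finset.mem_image.2 ⟨s, Finset.mem_univ _, (Finset.mem_filter.1 hs).2⟩
  rw [this, Real.zero_rpow hr.ne', ENNReal.ofReal_zero]

end Law

/-! ### The entropy inequalities. -/

/-- Here `(ENNReal.conjExponent α).toReal` is the Hölder conjugate `α' = α / (α - 1)`, equal to `1`
for `α = ∞`. If `σ = 0` then all three quantities being compared are `0`. -/
theorem mainTheorem9 {Ω : Type*} [MeasurableSpace Ω] (μ : Measure Ω) [IsProbabilityMeasure μ]
    (n : ℕ) (v : Fin n → ℝ) (hv : ∀ i, v i ≠ 0)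
    (B : Fin n → Ω → ℝ) (p : Fin n → unitInterval)
    (hB : ∀ i, HasLaw (B i) (bernoulliMeasure (1 : ℝ) 0 (p i)) μ)
    (hindep : iIndepFun B μ)
    (σ : ℝ) (hσ : σ ^ 2 = ∑ i, variance (B i) μ)
    (α : ℝ≥0∞) (hα : 2 ≤ α) (α' : ℝ) (hα' : α' = (ENNReal.conjExponent α).toReal) :
    ((Real.log (√(6 * σ ^ 2 * α') /
        ∫ t in (0 : ℝ)..√(6 * σ ^ 2 * α'), Real.exp (-t ^ 2 / 2)) : ℝ) : EReal)
      ≤ renyiEntropy α (fun ω => ∑ i, v i * B i ω) μ ∧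
    1 / 2 * max (Real.log (1 + 2 * α' * σ ^ 2)) (Real.log (12 * α' * σ ^ 2 / Real.pi))
      ≤ Real.log (√(6 * σ ^ 2 * α') /
        ∫ t in (0 : ℝ)..√(6 * σ ^ 2 * α'), Real.exp (-t ^ 2 / 2)) := by
  have hα'0 : 0 ≤ α' := hα' ▸ ENNReal.toReal_nonneg
  have hR2 : √(6 * σ ^ 2 * α') ^ 2 = 6 * σ ^ 2 * α' := Real.sq_sqrt (by positivity)
  refine ⟨?_, ?_⟩
  swap
  · refine le_of_eq_of_le ?_ (half_max_log_le_log_div_integral (Real.sqrt_nonneg _))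
    rw [hR2]
    congr 4 <;> ring
  have hσ' : σ ^ 2 = ∑ i, (p i : ℝ) * (1 - p i) :=
    hσ.trans (Finset.sum_congr rfl fun i _ => variance_of_hasLaw_bernoulli (hB i))
  have hp : ∀ i, (p i : ℝ) ∈ Set.Icc (0 : ℝ) 1 := fun i => (p i).2
  rw [log_div_integral_eq (Real.sqrt_nonneg _), hR2]
  set J : ℝ := ∫ u in (0 : ℝ)..1, Real.exp (-(6 * σ ^ 2 * α' * u ^ 2 / 2)) with hJ
  have hJpos : 0 < J := intervalIntegral.intervalIntegral_pos_of_pos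
    (Continuous.intervalIntegrable (by fun_prop) _ _) (fun _ => Real.exp_pos _) zero_lt_one
  -- The constants agree because `2 * (3 / 2) = 6 / 2`; this is the source of the `6` under the
  -- square root.
  have hJeq : ∫ u in (0 : ℝ)..1,
      Real.exp (-(2 * (α' * ∑ i, (p i : ℝ) * (1 - p i)) * (3 / 2 * u ^ 2))) = J := by
    rw [hJ, hσ']
    congr 1
    ext u
    ring_nf
  have hα0 : α ≠ 0 := fun h => by simp [h] at hα
  have hα1 : α ≠ 1 := fun h => by
    rw [h] at hα
    exact absurd hα (by norm_num)
  rw [renyiEntropy, if_neg hα0, if_neg hα1]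
  split_ifs with htop
  · have h1 : α' = 1 := by rw [hα', htop]; simp [ENNReal.conjExponent]
    rw [h1] at hJeq
    rw [EReal.coe_neg, EReal.neg_le_neg_iff, ← ENNReal.log_ofReal_of_pos hJpos]
    refine ENNReal.log_le_log (iSup_le fun x => ?_)
    refine (measure_sum_bernoulli_le v hB hindep x).trans (ENNReal.ofReal_le_ofReal ?_)
    exact (bernoulliSumMass_le hp hv x).trans_eq hJeq
  · set r := α.toReal with hr
    have hr2 : 2 ≤ r := (ENNReal.toReal_mono htop hα)
    have hrq : r.HolderConjugate α' := by
      rw [Real.holderConjugate_iff_eq_conjExponent (by linarith), hα', ENNReal.conjExponent,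
        ENNReal.toReal_add (by simp) (by
          simpa [tsub_eq_zero_iff_le] using lt_of_lt_of_le (by norm_num) hα),
        ENNReal.toReal_inv, ENNReal.toReal_sub_of_le (le_trans (by norm_num) hα) htop]
      have : r - 1 ≠ 0 := by linarith
      rw [ENNReal.toReal_one, ← hr]
      field_simp
      ring
    have hsum : ∑' x, μ ((fun ω => ∑ i, v i * B i ω) ⁻¹' {x}) ^ r ≤ ENNReal.ofReal (J ^ (r - 1)) :=
      (tsum_measure_sum_bernoulli_rpow_le v hB hindep (by linarith)).trans
        (ENNReal.ofReal_le_ofReal ((sum_bernoulliSumMass_rpow_le hp hv hr2 hrq).trans_eq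
          (by rw [hJeq])))
    -- The entropy prefactor is nonpositive, so the upper bound on the power sum becomes a lower
    -- bound on the entropy; the exponent `r - 1` cancels against it, leaving `-log J`.
    have hneg : (((1 - r)⁻¹ : ℝ) : EReal) ≤ 0 := by
      exact_mod_cast inv_nonpos.2 (by linarith : 1 - r ≤ 0)
    have hlog := ENNReal.log_le_log hsum
    rw [ENNReal.log_ofReal_of_pos (by positivity), Real.log_rpow hJpos] at hlog
    rw [mul_comm]
    refine le_trans (le_of_eq ?_) (EReal.mul_le_mul_of_nonpos_right hlog hneg)
    rw [← EReal.coe_mul]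
    congr 1
    have : 1 - r ≠ 0 := by linarith
    field_simp
    ring
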